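/- **Setting.** Fix a set of non-null values together with total functions, predicates and aggregate functions (from finite bags of values to values) on it; equality is one of the predicates. *Expressions* are built from attributes, (non-null) constants and functions. *Formulas* are built from TRUE, predicates over expressions, "$e$ IS NULL", "$R$ MISSING $a$", "$\vec e$ IN (subquery)", "$e\,\theta$ ANY/ALL (subquery)" with uncorrelated subqueries, by AND, OR, NOT. A *query* is a relation name, or SELECT $\vec e$ FROM $\vec R$ WHERE $\phi$, or SELECT $\vec e,\vec\gamma$ FROM $\vec R$ WHERE $\phi$ GROUP BY $\vec v$, where the members of $\vec R$ are relations or subqueries, the $e_j$ of a grouping query are expressions over the grouping attributes $\vec v$, and each $\gamma_j$ is an aggregate function applied to an expression. A query is a *standard (3VL) query* if MISSING does not occur in it or in its subqueries. **Standard semantics.** A table is a finite bag of rows whose entries are values or NULL. A function or an aggregate function with a NULL input gives NULL; a predicate with a NULL argument is UNKNOWN, except IS NULL, which is TRUE or FALSE; AND, OR, NOT, IN, ANY, ALL follow Kleene's three-valued logic. A choice of one tuple from each member of $\vec R$ is kept if $\phi$ is TRUE; a grouping query has one output row for each (non-empty) group. **Column Normal Form (CNF).** A relation with $n$ columns in CNF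 consists of a finite set $R_{\mathrm{id}}$ of opaque keys and, for each column $a$, a relation $R_a$ that assigns at most one value to each key of $R_{\mathrm{id}}$ and none to anything else; an entry is missing if a key has no value in $R_a$. Normalizing a table means giving each row its own key and dropping the NULL entries. The full outer join of a CNF relation is the table with one row for each key, with NULL for the missing entries, without the key column. An instance in CNF gives a CNF relation for each relation name. Opaque keys matter only up to renaming. **Columnar Semantics.** The output on a CNF instance is again in CNF. Each output column $o$ (an $e_j$ or a $\gamma_j$) is the result of an expanded query: choose a key $\kappa_R\in R_{\mathrm{id}}$ for each $R$ in $\vec R$, and for each attribute $R.a$ that occurs in $\phi$, $\vec v$ or $o$ an entry $(\kappa_R,x)\in R_a$; keep the choice if $\phi$ is TRUE for these values, where $R$ MISSING $a$ (which does not count as an occurrence of $R.a$) means that $\kappa_R$ has no value in $R_a$, and an IN/ANY/ALL subquery stands for its output rows without missing entries. Without GROUP BY, the column consists of the pairs of $(\kappa_R)_R$ and the value of $o$. With GROUP BY, the choices are grouped by the values of $\vec v$, the key of an output row is the value of $\vec v$ on the group, and the column consists of the pairs of a (non-empty) group's key and the value of $o$ on the group. The key relation of the output comes from the same query with no $o$.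 A subquery in $\vec R$ is replaced by its output in CNF. **Proposition.** For every query $Q_{\mathrm{cs}}$ there is a standard query $Q_{\mathrm{3vl}}$, depending only on $Q_{\mathrm{cs}}$, such that for every instance $I'$ in CNF the following holds: if $O'$ is the result of $Q_{\mathrm{cs}}$ on $I'$ under Columnar Semantics, $I$ is the full outer join of $I'$ (relation by relation), and $O$ is the result of $Q_{\mathrm{3vl}}$ on $I$ under the standard semantics, then normalizing $O$ into Column Normal Form gives $O'$, up to renaming of the opaque keys. Moreover, if $I'$ has no missing entries and $Q_{\mathrm{cs}}$ does not use MISSING, then this holds on $I'$ with $Q_{\mathrm{3vl}}=Q_{\mathrm{cs}}$. -/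

import Mathlib

namespace SQL

open scoped Classical

/-! ## Syntax -/

/-- What a SQL dialect offers: the non-null values, the functions, the predicates and the
aggregate functions, each with its meaning on non-null values. -/
structure Dialect where
  Val : Type
  Fn : ℕ → Type
  fn : ∀ {n}, Fn n → (Fin n → Val) → Val
  Pr : ℕ → Type
  pr : ∀ {n}, Pr n → (Fin n → Val) → Prop
  Agg : Type
  agg : Agg → Multiset Val → Val

/-- A database schema: relation names with their numbers of columns. -/
structure Schema where
  Rel : Type
  arity : Rel → ℕ

/-- Predicates: equality, and those of the dialect. -/
inductive Pred (S : Dialect) : ℕ → Type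
  | eq : Pred S 2
  | sym {n : ℕ} (p : S.Pr n) : Pred S n

/-- Meaning of a predicate on non-null values. -/
def Pred.holds {S : Dialect} : {n : ℕ} → Pred S n → (Fin n → S.Val) → Prop
  | _, .eq, w => w 0 = w 1
  | _, .sym p, w => S.pr p w

/-- Expressions over the attributes `A`: attributes, constants, function applications. -/
inductive Expression (S : Dialect) (A : Type) : Type
  | attr (a : A) : Expression S A
  | const (c : S.Val) : Expression S A
  | app {n : ℕ} (f : S.Fn n) (args : Fin n → Expression S A) : Expression S A

/-- The attributes of the items of a `FROM` list, where item `i` has `ks i` columns. -/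
abbrev Attr {m : ℕ} (ks : Fin m → ℕ) : Type := Σ i : Fin m, Fin (ks i)

/-- Formulas of a `WHERE` clause over the attributes `A`. The subqueries used in the clause are
referred to by an index `j : Fin s`; `ws j` is the number of columns of the `j`-th one. -/
inductive Formula (S : Dialect) (A : Type) {s : ℕ} (ws : Fin s → ℕ) : Type
  | tru : Formula S A ws
  | pred {n : ℕ} (p : Pred S n) (args : Fin n → Expression S A) : Formula S A ws
  /-- `e IS NULL` -/
  | isNull (e : Expression S A) : Formula S A ws
  /-- `R MISSING a`, for the attribute `R.a` -/
  | missing (a : A) : Formula S A ws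
  /-- `(e₁, …, eₖ) IN (subquery)` -/
  | isIn (j : Fin s) (e : Fin (ws j) → Expression S A) : Formula S A ws
  /-- `e p ANY (subquery)` -/
  | any (p : Pred S 2) (e : Expression S A) (j : Fin s) (h : ws j = 1) : Formula S A ws
  /-- `e p ALL (subquery)` -/
  | all (p : Pred S 2) (e : Expression S A) (j : Fin s) (h : ws j = 1) : Formula S A ws
  | and (φ ψ : Formula S A ws) : Formula S A ws
  | or (φ ψ : Formula S A ws) : Formula S A ws
  | not (φ : Formula S A ws) : Formula S A ws

/-- An output column of a grouping query: an expression over the `g` grouping attributes, or an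
aggregate function applied to an expression over all attributes. -/
inductive GroupColumn (S : Dialect) (A : Type) (g : ℕ) : Type
  | key (e : Expression S (Fin g)) : GroupColumn S A g
  | agg (γ : S.Agg) (e : Expression S A) : GroupColumn S A g

/-- Queries with `n` output columns. `src` is the `FROM` list, whose items are relations or
subqueries, and `sub` lists the subqueries to which the `WHERE` formula refers. -/
inductive Query (S : Dialect) (D : Schema) : ℕ → Type
  /-- a relation of the database -/
  | table (R : D.Rel) : Query S D (D.arity R)
  /-- `SELECT out FROM src WHERE φ` -/
  | select {m s n : ℕ} {ks : Fin m → ℕ} {ws : Fin s → ℕ}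
      (src : ∀ i, Query S D (ks i)) (sub : ∀ j, Query S D (ws j))
      (φ : Formula S (Attr ks) ws) (out : Fin n → Expression S (Attr ks)) : Query S D n
  /-- `SELECT out FROM src WHERE φ GROUP BY v` -/
  | group {m s g n : ℕ} {ks : Fin m → ℕ} {ws : Fin s → ℕ}
      (src : ∀ i, Query S D (ks i)) (sub : ∀ j, Query S D (ws j))
      (φ : Formula S (Attr ks) ws) (v : Fin g → Attr ks)
      (out : Fin n → GroupColumn S (Attr ks) g) : Query S D n

/-- The formula does not use `MISSING`. -/
def Formula.NoMissing {S : Dialect} {A : Type} {s : ℕ} {ws : Fin s → ℕ} :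
    Formula S A ws → Prop
  | .missing _ => False
  | .and φ ψ => φ.NoMissing ∧ ψ.NoMissing
  | .or φ ψ => φ.NoMissing ∧ ψ.NoMissing
  | .not φ => φ.NoMissing
  | _ => True

/-- The query, with all its subqueries, does not use `MISSING`: it is a standard SQL query. -/
def Query.NoMissing {S : Dialect} {D : Schema} : {n : ℕ} → Query S D n → Prop
  | _, .table _ => True
  | _, .select src sub φ _ =>
      (∀ i, (src i).NoMissing) ∧ (∀ j, (sub j).NoMissing) ∧ φ.NoMissing
  | _, .group src sub φ _ _ =>
      (∀ i, (src i).NoMissing) ∧ (∀ j, (sub j).NoMissing) ∧ φ.NoMissing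

/-- The attributes `R.a` that occur in an expression. -/
def Expression.attrs {S : Dialect} {A : Type} : Expression S A → Set A
  | .attr a => {a}
  | .const _ => ∅
  | .app _ args => ⋃ i, (args i).attrs

/-- The attributes `R.a` that occur in a formula. `R MISSING a` asks for the absence of an entry;
it is not an occurrence of `R.a`. -/
def Formula.attrs {S : Dialect} {A : Type} {s : ℕ} {ws : Fin s → ℕ} : Formula S A ws → Set A
  | .tru => ∅
  | .pred _ args => ⋃ i, (args i).attrs
  | .isNull e => e.attrs
  | .missing _ => ∅
  | .isIn _ e => ⋃ i, (e i).attrs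
  | .any _ e _ _ => e.attrs
  | .all _ e _ _ => e.attrs
  | .and φ ψ => φ.attrs ∪ ψ.attrs
  | .or φ ψ => φ.attrs ∪ ψ.attrs
  | .not φ => φ.attrs

/-! ## Three-valued logic -/

/-- `TRUE`, `FALSE`, `UNKNOWN`. -/
inductive Truth : Type
  | t | f | u

namespace Truth

def and : Truth → Truth → Truth
  | f, _ => f
  | _, f => f
  | t, t => t
  | _, _ => u

def or : Truth → Truth → Truth
  | t, _ => t
  | _, t => t
  | f, f => f
  | _, _ => u

def not : Truth → Truth
  | t => f
  | f => t
  | u => u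

noncomputable def ofProp (P : Prop) : Truth := if P then t else f

/-- Disjunction of a set of truth values. -/
noncomputable def sup (s : Set Truth) : Truth := if t ∈ s then t else if u ∈ s then u else f

/-- Conjunction of a set of truth values. -/
noncomputable def inf (s : Set Truth) : Truth := if f ∈ s then f else if u ∈ s then u else t

end Truth

/-- The tuple of values, if no component is null (`none`). -/
noncomputable def allSome {V : Type} {n : ℕ} (x : Fin n → Option V) : Option (Fin n → V) :=
  if h : ∀ i, (x i).isSome then some fun i => (x i).get (h i) else none

/-- Value of an expression; a null input gives a null output. -/
noncomputable def Expression.eval {S : Dialect} {A : Type} (ρ : A → Option S.Val) :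
    Expression S A → Option S.Val
  | .attr a => ρ a
  | .const c => some c
  | .app f args => (allSome fun i => (args i).eval ρ).map (S.fn f)

/-- Truth value of a predicate; `UNKNOWN` if an argument is null. -/
noncomputable def Pred.eval {S : Dialect} {n : ℕ} (p : Pred S n) (x : Fin n → Option S.Val) :
    Truth :=
  match allSome x with
  | some w => Truth.ofProp (p.holds w)
  | none => Truth.u

/-- Truth value of a formula, where `ρ` gives the values of the attributes, `miss` tells when
`R MISSING a` holds, and `rows j` is the set of rows returned by the `j`-th subquery. -/
noncomputable def Formula.eval {S : Dialect} {A : Type} {s : ℕ} {ws : Fin s → ℕ}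
    (rows : ∀ j, Set (Fin (ws j) → Option S.Val)) (miss : A → Prop) (ρ : A → Option S.Val) :
    Formula S A ws → Truth
  | .tru => Truth.t
  | .pred p args => p.eval fun i => (args i).eval ρ
  | .isNull e => Truth.ofProp (e.eval ρ = none)
  | .missing a => Truth.ofProp (miss a)
  | .isIn j e =>
      Truth.sup ((fun r => Truth.inf (Set.range fun c => Pred.eq.eval ![(e c).eval ρ, r c])) ''
        rows j)
  | .any p e j h =>
      Truth.sup ((fun r => p.eval ![e.eval ρ, r (Fin.cast h.symm 0)]) '' rows j)
  | .all p e j h =>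
      Truth.inf ((fun r => p.eval ![e.eval ρ, r (Fin.cast h.symm 0)]) '' rows j)
  | .and φ ψ => (φ.eval rows miss ρ).and (ψ.eval rows miss ρ)
  | .or φ ψ => (φ.eval rows miss ρ).or (ψ.eval rows miss ρ)
  | .not φ => (φ.eval rows miss ρ).not

/-! ## The standard semantics -/

/-- A table with nulls: a finite bag of rows. -/
abbrev Table (V : Type) (n : ℕ) : Type := Multiset (Fin n → Option V)

/-- A database instance with nulls. -/
abbrev Instance (S : Dialect) (D : Schema) : Type := ∀ R : D.Rel, Table S.Val (D.arity R)

/-- Cartesian product of bags. -/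
def bagProduct : {m : ℕ} → {α : Fin m → Type} → (∀ i, Multiset (α i)) → Multiset (∀ i, α i)
  | 0, _, _ => {fun i => i.elim0}
  | _ + 1, _, T =>
      (T 0).bind fun x => (bagProduct fun i => T i.succ).map fun r => Fin.cons x r

/-- The choices of one tuple from each item of the `FROM` list that make the `WHERE` formula
true. `MISSING` is not a construct of standard SQL; here it would be a test for null. -/
noncomputable def standardRows {S : Dialect} {m s : ℕ} {ks : Fin m → ℕ} {ws : Fin s → ℕ}
    (T : ∀ i, Table S.Val (ks i)) (sub : ∀ j, Table S.Val (ws j))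
    (φ : Formula S (Attr ks) ws) : Multiset (Attr ks → Option S.Val) :=
  ((bagProduct T).map fun r (a : Attr ks) => r a.1 a.2).filter fun ρ =>
    φ.eval (fun j => {r | r ∈ sub j}) (fun a => ρ a = none) ρ = Truth.t

/-- An aggregate function applied to a bag; a null input gives a null output. -/
noncomputable def aggregate {S : Dialect} (γ : S.Agg) (b : Multiset (Option S.Val)) :
    Option S.Val :=
  if none ∈ b then none else some (S.agg γ (b.filterMap id))

/-- The standard (three-valued logic, bag) semantics. -/
noncomputable def Query.evalStandard {S : Dialect} {D : Schema} (I : Instance S D) :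
    {n : ℕ} → Query S D n → Table S.Val n
  | _, .table R => I R
  | _, .select src sub φ out =>
      (standardRows (fun i => (src i).evalStandard I) (fun j => (sub j).evalStandard I) φ).map
        fun ρ c => (out c).eval ρ
  | _, .group src sub φ v out =>
      let rows := standardRows (fun i => (src i).evalStandard I)
        (fun j => (sub j).evalStandard I) φ
      (rows.map fun ρ i => ρ (v i)).dedup.map fun w c =>
        match out c with
        | .key e => e.eval w
        | .agg γ e => aggregate γ ((rows.filter fun ρ => (fun i => ρ (v i)) = w).map e.eval)

/-! ## Column Normal Form -/

/-- A relation with `n` columns in Column Normal Form: the relation `ids` holding the opaque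
keys and, for each column, a relation assigning values to some of the keys. -/
structure ColumnNF (V : Type) (n : ℕ) where
  Key : Type
  ids : Finset Key
  col : Fin n → Set (Key × V)
  key_mem : ∀ a k v, (k, v) ∈ col a → k ∈ ids
  functional : ∀ a k v v', (k, v) ∈ col a → (k, v') ∈ col a → v = v'

/-- A database instance in Column Normal Form. -/
abbrev ColumnInstance (S : Dialect) (D : Schema) : Type 1 :=
  ∀ R : D.Rel, ColumnNF S.Val (D.arity R)

/-- The element satisfying `P`, or null if there is none. -/
noncomputable def theOption {V : Type} (P : V → Prop) : Option V :=
  if h : ∃ v, P v then some h.choose else none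

namespace ColumnNF

/-- No entry is missing. -/
def Complete {V : Type} {n : ℕ} (C : ColumnNF V n) : Prop :=
  ∀ k ∈ C.ids, ∀ a, ∃ v, (k, v) ∈ C.col a

/-- The full outer join on the key of the `n + 1` relations, without the opaque key column. -/
noncomputable def fullOuterJoin {V : Type} {n : ℕ} (C : ColumnNF V n) : Table V n :=
  C.ids.val.map fun k a => theOption fun v => (k, v) ∈ C.col a

/-- Normalizing a table: the rows are numbered, and null entries are dropped. -/
noncomputable def normalize {V : Type} {n : ℕ} (T : Table V n) : ColumnNF V n where
  Key := Fin T.toList.length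
  ids := Finset.univ
  col a := {p | T.toList.get p.1 a = some p.2}
  key_mem _ _ _ _ := Finset.mem_univ _
  functional _ _ _ _ h h' := Option.some.inj (Eq.trans (Eq.symm h) h')

/-- `C` and `C'` agree up to a renaming of the opaque keys. -/
def Same {V : Type} {n : ℕ} (C C' : ColumnNF V n) : Prop :=
  ∃ f : C.Key → C'.Key, Set.BijOn f C.ids C'.ids ∧
    ∀ a, ∀ k ∈ C.ids, ∀ v, (k, v) ∈ C.col a ↔ (f k, v) ∈ C'.col a

/-- The rows without a missing entry. -/
def presentRows {V : Type} {n : ℕ} (C : ColumnNF V n) : Set (Fin n → Option V) :=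
  {r | ∃ k ∈ C.ids, ∀ a, ∃ v, (k, v) ∈ C.col a ∧ r a = some v}

end ColumnNF

/-! ## Columnar Semantics -/

section Columnar

variable {S : Dialect} {m s : ℕ} {ks : Fin m → ℕ} {ws : Fin s → ℕ}

/-- `ρ` arises by choosing, for each attribute `R.a` in `U`, a tuple of the relation `R_a` with
`R_a.id = R_id.id`, where `κ` is the choice of a key from `R_id` for each `R`. -/
def Joined (C : ∀ i, ColumnNF S.Val (ks i)) (U : Set (Attr ks)) (κ : ∀ i, (C i).Key)
    (ρ : Attr ks → Option S.Val) : Prop :=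
  ∀ a ∈ U, ∃ x, (κ a.1, x) ∈ (C a.1).col a.2 ∧ ρ a = some x

/-- The `FROM` and `WHERE` clauses of an expanded query that uses the attributes in `U` besides
those of `φ`: all joins succeed and the formula is true. `R MISSING a` stands for
`R_id.id NOT IN (SELECT id FROM R_a)`, and a subquery for its rows of present values. -/
def ExpandedWhere (C : ∀ i, ColumnNF S.Val (ks i)) (sub : ∀ j, ColumnNF S.Val (ws j))
    (φ : Formula S (Attr ks) ws) (U : Set (Attr ks)) (κ : ∀ i, (C i).Key)
    (ρ : Attr ks → Option S.Val) : Prop :=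
  (∀ i, κ i ∈ (C i).ids) ∧ Joined C (φ.attrs ∪ U) κ ρ ∧
    φ.eval (fun j => (sub j).presentRows) (fun a => ∀ x, (κ a.1, x) ∉ (C a.1).col a.2) ρ
      = Truth.t

theorem Expression.eval_congr {A : Type} (e : Expression S A) {ρ ρ' : A → Option S.Val}
    (h : ∀ a ∈ e.attrs, ρ a = ρ' a) : e.eval ρ = e.eval ρ' := by
  induction e with
  | attr a => exact h a rfl
  | const c => rfl
  | app f args ih =>
    have : (fun i => (args i).eval ρ) = fun i => (args i).eval ρ' := by
      funext i
      exact ih i fun a ha => h a (Set.mem_iUnion.2 ⟨i, ha⟩)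
    simp only [Expression.eval, this]

theorem ExpandedWhere.eq_of_mem {C : ∀ i, ColumnNF S.Val (ks i)}
    {sub : ∀ j, ColumnNF S.Val (ws j)} {φ : Formula S (Attr ks) ws} {U : Set (Attr ks)}
    {κ : ∀ i, (C i).Key} {ρ ρ' : Attr ks → Option S.Val}
    (h : ExpandedWhere C sub φ U κ ρ) (h' : ExpandedWhere C sub φ U κ ρ') {a : Attr ks}
    (ha : a ∈ U) : ρ a = ρ' a := by
  obtain ⟨x, hx, e⟩ := h.2.1 a (Or.inr ha)
  obtain ⟨x', hx', e'⟩ := h'.2.1 a (Or.inr ha)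
  rw [e, e', (C a.1).functional _ _ _ _ hx hx']

theorem ExpandedWhere.mono {C : ∀ i, ColumnNF S.Val (ks i)}
    {sub : ∀ j, ColumnNF S.Val (ws j)} {φ : Formula S (Attr ks) ws} {U U' : Set (Attr ks)}
    (hU : U ⊆ U') {κ : ∀ i, (C i).Key} {ρ : Attr ks → Option S.Val}
    (h : ExpandedWhere C sub φ U' κ ρ) : ExpandedWhere C sub φ U κ ρ :=
  ⟨h.1, fun a ha => h.2.1 a (Set.union_subset_union_right _ hU ha), h.2.2⟩

/-- Results of the expanded queries of `SELECT out FROM C WHERE φ`: the key relation is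
`SELECT ids FROM … WHERE …`, and column `c` is `SELECT ids, out c FROM … WHERE …`. -/
noncomputable def columnarSelect {n : ℕ} (C : ∀ i, ColumnNF S.Val (ks i))
    (sub : ∀ j, ColumnNF S.Val (ws j)) (φ : Formula S (Attr ks) ws)
    (out : Fin n → Expression S (Attr ks)) : ColumnNF S.Val n where
  Key := ∀ i, (C i).Key
  ids := (Fintype.piFinset fun i => (C i).ids).filter fun κ =>
    ∃ ρ, ExpandedWhere C sub φ ∅ κ ρ
  col c := {p | ∃ ρ, ExpandedWhere C sub φ (out c).attrs p.1 ρ ∧ (out c).eval ρ = some p.2}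
  key_mem := by
    rintro c κ x ⟨ρ, h, -⟩
    exact Finset.mem_filter.2
      ⟨Fintype.mem_piFinset.2 h.1, ρ, h.mono (Set.empty_subset _)⟩
  functional := by
    rintro c κ x x' ⟨ρ, h, e⟩ ⟨ρ', h', e'⟩
    have := (out c).eval_congr fun a ha => h.eq_of_mem h' ha
    exact Option.some.inj (e.symm.trans (this.trans e'))

/-- The choice of keys `κ` gives a row of an expanded query with group `w` and value `x` of the
expression `e`. -/
def GroupRow {g : ℕ} (C : ∀ i, ColumnNF S.Val (ks i)) (sub : ∀ j, ColumnNF S.Val (ws j))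
    (φ : Formula S (Attr ks) ws) (v : Fin g → Attr ks) (e : Expression S (Attr ks))
    (w : Fin g → S.Val) (κ : ∀ i, (C i).Key) (x : S.Val) : Prop :=
  ∃ ρ, ExpandedWhere C sub φ (Set.range v ∪ e.attrs) κ ρ ∧ (∀ i, ρ (v i) = some (w i)) ∧
    e.eval ρ = some x

/-- The bag of the values of `e` in the group `w`. -/
noncomputable def groupBag {g : ℕ} (C : ∀ i, ColumnNF S.Val (ks i))
    (sub : ∀ j, ColumnNF S.Val (ws j)) (φ : Formula S (Attr ks) ws) (v : Fin g → Attr ks)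
    (e : Expression S (Attr ks)) (w : Fin g → S.Val) : Multiset S.Val :=
  (Fintype.piFinset fun i => (C i).ids).val.filterMap fun κ =>
    theOption (GroupRow C sub φ v e w κ)

/-- The groups. -/
def groupKeys {g : ℕ} (C : ∀ i, ColumnNF S.Val (ks i)) (sub : ∀ j, ColumnNF S.Val (ws j))
    (φ : Formula S (Attr ks) ws) (v : Fin g → Attr ks) : Set (Fin g → S.Val) :=
  {w | ∃ κ ρ, ExpandedWhere C sub φ (Set.range v) κ ρ ∧ ∀ i, ρ (v i) = some (w i)}

theorem groupKeys_finite {g : ℕ} (C : ∀ i, ColumnNF S.Val (ks i))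
    (sub : ∀ j, ColumnNF S.Val (ws j)) (φ : Formula S (Attr ks) ws) (v : Fin g → Attr ks) :
    (groupKeys C sub φ v).Finite := by
  have hfin : (⋃ κ ∈ (Fintype.piFinset fun i => (C i).ids),
      {w : Fin g → S.Val | ∃ ρ, ExpandedWhere C sub φ (Set.range v) κ ρ ∧
        ∀ i, ρ (v i) = some (w i)}).Finite := by
    refine Set.Finite.biUnion (Finset.finite_toSet _) fun κ _ => Set.Subsingleton.finite ?_
    rintro w ⟨ρ, h, e⟩ w' ⟨ρ', h', e'⟩
    funext i
    have := h.eq_of_mem h' (Set.mem_range_self i)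
    exact Option.some.inj ((e i).symm.trans (this.trans (e' i)))
  refine hfin.subset ?_
  rintro w ⟨κ, ρ, h, e⟩
  exact Set.mem_biUnion (Fintype.mem_piFinset.2 h.1) ⟨ρ, h, e⟩

/-- Column of the expanded query for one output column, as a relation from groups to values. -/
def groupColumn {g : ℕ} (C : ∀ i, ColumnNF S.Val (ks i)) (sub : ∀ j, ColumnNF S.Val (ws j))
    (φ : Formula S (Attr ks) ws) (v : Fin g → Attr ks) :
    GroupColumn S (Attr ks) g → Set ((Fin g → S.Val) × S.Val)
  | .key e => {p | p.1 ∈ groupKeys C sub φ v ∧ e.eval (fun i => some (p.1 i)) = some p.2}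
  | .agg γ e => {p | groupBag C sub φ v e p.1 ≠ 0 ∧ p.2 = S.agg γ (groupBag C sub φ v e p.1)}

theorem mem_groupKeys_of_mem_groupColumn {g : ℕ} {C : ∀ i, ColumnNF S.Val (ks i)}
    {sub : ∀ j, ColumnNF S.Val (ws j)} {φ : Formula S (Attr ks) ws} {v : Fin g → Attr ks}
    {o : GroupColumn S (Attr ks) g} {w : Fin g → S.Val} {x : S.Val}
    (h : (w, x) ∈ groupColumn C sub φ v o) : w ∈ groupKeys C sub φ v := by
  cases o with
  | key e => exact h.1
  | agg γ e =>
    obtain ⟨y, hy⟩ := Multiset.exists_mem_of_ne_zero h.1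
    obtain ⟨κ, -, hκ⟩ := (Multiset.mem_filterMap _ _).1 hy
    unfold theOption at hκ
    split_ifs at hκ with hex
    obtain ⟨z, ρ, h1, h2, -⟩ := hex
    exact ⟨κ, ρ, h1.mono Set.subset_union_left, h2⟩

/-- Results of the expanded queries of `SELECT out FROM C WHERE φ GROUP BY v`. The output has one
row for each group, with the values of the grouping attributes as its key. -/
noncomputable def columnarGroup {g n : ℕ} (C : ∀ i, ColumnNF S.Val (ks i))
    (sub : ∀ j, ColumnNF S.Val (ws j)) (φ : Formula S (Attr ks) ws) (v : Fin g → Attr ks)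
    (out : Fin n → GroupColumn S (Attr ks) g) : ColumnNF S.Val n where
  Key := Fin g → S.Val
  ids := (groupKeys_finite C sub φ v).toFinset
  col c := groupColumn C sub φ v (out c)
  key_mem _ _ _ h := (Set.Finite.mem_toFinset _).2 (mem_groupKeys_of_mem_groupColumn h)
  functional := by
    intro c w x x' h h'
    cases ho : out c with
    | key e =>
      rw [ho] at h h'
      exact Option.some.inj (h.2.symm.trans h'.2)
    | agg γ e =>
      rw [ho] at h h'
      exact h.2.trans h'.2.symm

end Columnar

/-- Columnar Semantics: the result, in Column Normal Form, of the expanded queries. -/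
noncomputable def Query.evalColumnar {S : Dialect} {D : Schema} (I : ColumnInstance S D) :
    {n : ℕ} → Query S D n → ColumnNF S.Val n
  | _, .table R => I R
  | _, .select src sub φ out =>
      columnarSelect (fun i => (src i).evalColumnar I) (fun j => (sub j).evalColumnar I) φ out
  | _, .group src sub φ v out =>
      columnarGroup (fun i => (src i).evalColumnar I) (fun j => (sub j).evalColumnar I) φ v out

/-- The full outer join of every group of normalized relations. -/
noncomputable def ColumnInstance.fullOuterJoin {S : Dialect} {D : Schema}
    (I : ColumnInstance S D) : Instance S D :=
  fun R => (I R).fullOuterJoin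

/-- The instance has no missing entries. -/
def ColumnInstance.Complete {S : Dialect} {D : Schema} (I : ColumnInstance S D) : Prop :=
  ∀ R, (I R).Complete

end SQL

namespace SQL

open scoped Classical

/-! ## Nulls in expressions and predicates -/

/-! The full outer join loses nothing but the names of the keys
(`ColumnNF.normalize_fullOuterJoin_same`). So it suffices to find a standard query whose output is,
as a bag, the full outer join of the columnar output; this is `Query.evalStandard_toStandard`, by
induction on the query.

A choice `κ` of keys determines one row with nulls, `keyRow C κ`. The expanded query using the
attributes `U` keeps `κ` exactly if the entries for `φ.attrs ∪ U` are present and `φ` is true on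
this row, with MISSING read as a null test (`expandedWhere_iff`). Hence the standard WHERE clause is
`φ` with MISSING replaced by IS NULL, plus IS NOT NULL for the attributes of `φ` and the grouping
attributes; WHERE subqueries are first stripped of rows with nulls. Output attributes need no such
condition: an expression is null iff one of its attributes is (`Expression.eval_ne_none_iff`), so a
failed join in a column's expanded query is a null in the standard output.

Aggregates need more work. A columnar aggregate skips missing values and has no entry if a group has
none, whereas a standard aggregate is null as soon as one input is. Each aggregate column is
therefore computed by a query of its own, filtered so that its nulls disappear but no group does
(`Query.evalStandard_aggregatePresent`). The columns are then joined on the group keys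
(`Query.evalStandard_joinOnTail`).

On complete instances every intermediate result is complete, so all presence conditions hold, no
aggregate meets a null, and the original query already works (`Query.evalStandard_of_complete`). -/

theorem theOption_eq_some_iff {V : Type} {P : V → Prop} (h : ∀ v v', P v → P v' → v = v')
    {v : V} : theOption P = some v ↔ P v := by
  unfold theOption
  split_ifs with hex
  · rw [Option.some.injEq]
    exact ⟨fun e => e ▸ hex.choose_spec, fun hv => h _ _ hex.choose_spec hv⟩
  · exact ⟨fun e => by simp at e, fun hv => (hex ⟨v, hv⟩).elim⟩

theorem theOption_eq {V : Type} {P : V → Prop} {o : Option V} (h : ∀ v, P v ↔ o = some v) :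
    theOption P = o := by
  ext v
  rw [theOption_eq_some_iff, h]
  intro v v' hv hv'
  exact Option.some.inj (((h v).1 hv).symm.trans ((h v').1 hv'))

theorem allSome_some {V : Type} {n : ℕ} (w : Fin n → V) :
    allSome (fun i => some (w i)) = some w := by
  simp [allSome]

theorem allSome_ne_none_iff {V : Type} {n : ℕ} {x : Fin n → Option V} :
    allSome x ≠ none ↔ ∀ i, x i ≠ none := by
  unfold allSome
  split_ifs with h
  · simpa [Option.isSome_iff_ne_none] using h
  · simpa [Option.isSome_iff_ne_none] using h

/-- Functions are total on values and strict in nulls, so nulls can only come from attributes, and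
always propagate. -/
theorem Expression.eval_ne_none_iff {S : Dialect} {A : Type} {ρ : A → Option S.Val}
    (e : Expression S A) : e.eval ρ ≠ none ↔ ∀ a ∈ e.attrs, ρ a ≠ none := by
  induction e with
  | attr a => simp [Expression.eval, Expression.attrs]
  | const c => simp [Expression.eval, Expression.attrs]
  | app f args ih =>
    have h : (Expression.app f args).eval ρ ≠ none ↔ ∀ i, (args i).eval ρ ≠ none := by
      rw [← allSome_ne_none_iff]
      simp [Expression.eval]
    rw [h]
    simp only [ih, Expression.attrs, Set.mem_iUnion]
    exact ⟨fun h a ⟨i, ha⟩ => h i a ha, fun h i a ha => h a ⟨i, ha⟩⟩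

theorem Pred.eval_eq_some_some {S : Dialect} (x y : S.Val) :
    (Pred.eq (S := S)).eval ![some x, some y] = Truth.ofProp (x = y) := by
  have : (![some x, some y] : Fin 2 → Option S.Val) = fun i => some ((![x, y] : Fin 2 → _) i) := by
    funext i
    fin_cases i <;> rfl
  rw [this, Pred.eval, allSome_some]
  rfl

theorem Truth.and_eq_t {a b : Truth} : a.and b = Truth.t ↔ a = Truth.t ∧ b = Truth.t := by
  cases a <;> cases b <;> simp [Truth.and]

theorem Truth.or_eq_t {a b : Truth} : a.or b = Truth.t ↔ a = Truth.t ∨ b = Truth.t := by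
  cases a <;> cases b <;> simp [Truth.or]

theorem Truth.ofProp_eq_t {P : Prop} : Truth.ofProp P = Truth.t ↔ P := by
  simp [Truth.ofProp]

theorem Truth.not_ofProp (P : Prop) : (Truth.ofProp P).not = Truth.ofProp (¬ P) := by
  by_cases h : P <;> simp [Truth.ofProp, Truth.not, h]

theorem Truth.sup_ofProp {ι : Type*} (s : Set ι) (P : ι → Prop) :
    Truth.sup ((fun i => Truth.ofProp (P i)) '' s) = Truth.ofProp (∃ i ∈ s, P i) := by
  have hu : Truth.u ∉ (fun i => Truth.ofProp (P i)) '' s := by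
    rintro ⟨i, -, h⟩
    by_cases hP : P i <;> simp [Truth.ofProp, hP] at h
  have ht : Truth.t ∈ (fun i => Truth.ofProp (P i)) '' s ↔ ∃ i ∈ s, P i := by
    simp [Truth.ofProp_eq_t]
  rw [Truth.sup, if_neg hu, Truth.ofProp]
  simp only [ht]

theorem Truth.inf_range_ofProp {ι : Type*} (P : ι → Prop) :
    Truth.inf (Set.range fun i => Truth.ofProp (P i)) = Truth.ofProp (∀ i, P i) := by
  have hu : Truth.u ∉ Set.range fun i => Truth.ofProp (P i) := by
    rintro ⟨i, h⟩
    by_cases hP : P i <;> simp [Truth.ofProp, hP] at h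
  have hf : Truth.f ∈ (Set.range fun i => Truth.ofProp (P i)) ↔ ¬ ∀ i, P i := by
    simp [Truth.ofProp]
  rw [Truth.inf, if_neg hu, Truth.ofProp]
  simp only [hf, ite_not]

/-! ## Formulas -/

namespace Formula

variable {S : Dialect} {A : Type} {s : ℕ} {ws : Fin s → ℕ}

/-- `ExpandedWhere` leaves `ρ` arbitrary outside the attributes in use; this allows replacing `ρ` by
the actual row. MISSING is harmless because it consults `miss` and not `ρ`. -/
theorem eval_congr (rows : ∀ j, Set (Fin (ws j) → Option S.Val)) (miss : A → Prop)
    {ρ ρ' : A → Option S.Val} (φ : Formula S A ws) (h : ∀ a ∈ φ.attrs, ρ a = ρ' a) :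
    φ.eval rows miss ρ = φ.eval rows miss ρ' := by
  induction φ with
  | tru => rfl
  | pred p args =>
    have : (fun i => (args i).eval ρ) = fun i => (args i).eval ρ' := by
      funext i
      exact (args i).eval_congr fun a ha => h a (Set.mem_iUnion.2 ⟨i, ha⟩)
    simp only [eval, this]
  | isNull e => simp only [eval, e.eval_congr h]
  | missing a => rfl
  | isIn j e =>
    have : ∀ i, (e i).eval ρ = (e i).eval ρ' := fun i =>
      (e i).eval_congr fun a ha => h a (Set.mem_iUnion.2 ⟨i, ha⟩)
    simp only [eval, this]
  | any p e j hj => simp only [eval, e.eval_congr h]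
  | all p e j hj => simp only [eval, e.eval_congr h]
  | and φ ψ hφ hψ =>
    simp only [eval, hφ fun a ha => h a (Or.inl ha), hψ fun a ha => h a (Or.inr ha)]
  | or φ ψ hφ hψ =>
    simp only [eval, hφ fun a ha => h a (Or.inl ha), hψ fun a ha => h a (Or.inr ha)]
  | not φ hφ => simp only [eval, hφ h]

/-- `R MISSING a` replaced by `R.a IS NULL`. -/
def missingToNull : Formula S A ws → Formula S A ws
  | .missing a => .isNull (.attr a)
  | .and φ ψ => .and φ.missingToNull ψ.missingToNull
  | .or φ ψ => .or φ.missingToNull ψ.missingToNull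
  | .not φ => .not φ.missingToNull
  | φ => φ

theorem noMissing_missingToNull (φ : Formula S A ws) : φ.missingToNull.NoMissing := by
  induction φ with
  | and φ ψ hφ hψ => exact ⟨hφ, hψ⟩
  | or φ ψ hφ hψ => exact ⟨hφ, hψ⟩
  | not φ hφ => exact hφ
  | _ => trivial

theorem eval_missingToNull (rows : ∀ j, Set (Fin (ws j) → Option S.Val)) (miss : A → Prop)
    (ρ : A → Option S.Val) (φ : Formula S A ws) :
    φ.missingToNull.eval rows miss ρ = φ.eval rows (fun a => ρ a = none) ρ := by
  induction φ with
  | and φ ψ hφ hψ => simp only [missingToNull, eval, hφ, hψ]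
  | or φ ψ hφ hψ => simp only [missingToNull, eval, hφ, hψ]
  | not φ hφ => simp only [missingToNull, eval, hφ]
  | _ => rfl

/-- Conjunction of a list of formulas. -/
def conj : List (Formula S A ws) → Formula S A ws
  | [] => .tru
  | φ :: l => .and φ (conj l)

theorem noMissing_conj {l : List (Formula S A ws)} (h : ∀ φ ∈ l, φ.NoMissing) :
    (conj l).NoMissing := by
  induction l with
  | nil => trivial
  | cons φ l ih =>
    exact ⟨h φ (List.mem_cons_self ..), ih fun ψ hψ => h ψ (List.mem_cons_of_mem _ hψ)⟩

theorem eval_conj_eq_t (rows : ∀ j, Set (Fin (ws j) → Option S.Val)) (miss : A → Prop)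
    (ρ : A → Option S.Val) (l : List (Formula S A ws)) :
    (conj l).eval rows miss ρ = Truth.t ↔ ∀ φ ∈ l, φ.eval rows miss ρ = Truth.t := by
  induction l with
  | nil => simp [conj, eval]
  | cons φ l ih => simp [conj, eval, Truth.and_eq_t, ih]

/-- All attributes in `U` are `NOT NULL`. -/
noncomputable def present [Fintype A] (U : Set A) : Formula S A ws :=
  conj (U.toFinset.toList.map fun a => .not (.isNull (.attr a)))

theorem noMissing_present [Fintype A] (U : Set A) :
    (present U : Formula S A ws).NoMissing := by
  refine noMissing_conj fun φ hφ => ?_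
  obtain ⟨a, -, rfl⟩ := List.mem_map.1 hφ
  trivial

theorem eval_present_eq_t [Fintype A] (rows : ∀ j, Set (Fin (ws j) → Option S.Val))
    (miss : A → Prop) (ρ : A → Option S.Val) (U : Set A) :
    (present U : Formula S A ws).eval rows miss ρ = Truth.t ↔ ∀ a ∈ U, ρ a ≠ none := by
  simp [present, eval_conj_eq_t, eval, Truth.not_ofProp, Truth.ofProp_eq_t, Expression.eval]

/-- The `WHERE` clause of a standard query that imitates the clause `φ` of an expanded query
using the attributes in `U`. -/
noncomputable def standardize [Fintype A] (φ : Formula S A ws) (U : Set A) : Formula S A ws :=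
  .and φ.missingToNull (present (φ.attrs ∪ U))

theorem noMissing_standardize [Fintype A] (φ : Formula S A ws) (U : Set A) :
    (φ.standardize U).NoMissing :=
  ⟨φ.noMissing_missingToNull, noMissing_present _⟩

theorem eval_standardize_eq_t [Fintype A] (rows : ∀ j, Set (Fin (ws j) → Option S.Val))
    (miss : A → Prop) (ρ : A → Option S.Val) (φ : Formula S A ws) (U : Set A) :
    (φ.standardize U).eval rows miss ρ = Truth.t ↔
      (∀ a ∈ φ.attrs ∪ U, ρ a ≠ none) ∧ φ.eval rows (fun a => ρ a = none) ρ = Truth.t := by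
  rw [standardize, eval, Truth.and_eq_t, eval_missingToNull, eval_present_eq_t, and_comm]

end Formula

/-! ## Bags indexed by finite sets -/

/-- Rows may repeat but keys do not. Indexing the product by choices of keys turns questions about
multiplicities into questions about finite sets. -/
theorem bagProduct_map : ∀ {m : ℕ} {α K : Fin m → Type} (F : ∀ i, Finset (K i))
    (f : ∀ i, K i → α i), bagProduct (fun i => (F i).val.map (f i)) =
      (Fintype.piFinset F).val.map fun κ i => f i (κ i)
  | 0, α, K, F, f => by
    have : Fintype.piFinset F = {fun i => i.elim0} := by
      ext κ
      simp only [Fintype.mem_piFinset, Finset.mem_singleton]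
      exact ⟨fun _ => funext fun i => i.elim0, fun _ i => i.elim0⟩
    rw [this, bagProduct]
    simp only [Finset.singleton_val, Multiset.map_singleton]
    congr 1
    funext i
    exact i.elim0
  | m + 1, α, K, F, f => by
    -- Splits off the first coordinate. Both sides are duplicate-free, so comparing members is
    -- enough.
    have h : (Fintype.piFinset F).val =
        ((F 0).val ×ˢ (Fintype.piFinset fun i => F (Fin.succ i)).val).map
          fun p => (Fin.cons p.1 p.2 : ∀ i, K i) := by
      refine (Multiset.Nodup.ext (Finset.nodup _) (Multiset.Nodup.map ?_ ?_)).2 ?_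
      · rintro ⟨x, r⟩ ⟨x', r'⟩ h
        exact Prod.ext (Fin.cons_injective2 h).1 (Fin.cons_injective2 h).2
      · exact Multiset.Nodup.product (Finset.nodup _) (Finset.nodup _)
      · intro κ
        simp only [Finset.mem_val, Fintype.mem_piFinset, Multiset.mem_map, Multiset.mem_product,
          Prod.exists]
        constructor
        · exact fun h => ⟨κ 0, fun i => κ i.succ, ⟨h 0, fun i => h i.succ⟩, Fin.cons_self_tail κ⟩
        · rintro ⟨x, r, ⟨hx, hr⟩, rfl⟩ i
          exact Fin.cases hx hr i
    rw [h, bagProduct, Multiset.map_map, bagProduct_map (fun i => F i.succ) fun i => f i.succ]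
    simp only [Multiset.map_map, SProd.sprod, Multiset.product, Multiset.map_bind,
      Multiset.bind_map]
    refine Multiset.bind_congr fun x _ => Multiset.map_congr rfl fun r _ => ?_
    funext i
    refine Fin.cases rfl (fun i => rfl) i

theorem standardRows_map {S : Dialect} {m s : ℕ} {ks : Fin m → ℕ} {ws : Fin s → ℕ}
    {K : Fin m → Type} (F : ∀ i, Finset (K i)) (f : ∀ i, K i → Fin (ks i) → Option S.Val)
    (sub : ∀ j, Table S.Val (ws j)) (φ : Formula S (Attr ks) ws) :
    standardRows (fun i => (F i).val.map (f i)) sub φ =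
      ((Fintype.piFinset F).filter fun κ => φ.eval (fun j => {r | r ∈ sub j})
        (fun a => f a.1 (κ a.1) a.2 = none) (fun a => f a.1 (κ a.1) a.2) = Truth.t).val.map
          fun κ a => f a.1 (κ a.1) a.2 := by
  rw [standardRows, bagProduct_map, Multiset.map_map, Multiset.filter_map, Finset.filter_val]
  rfl

/-! ## Column Normal Form -/

namespace ColumnNF

variable {V : Type} {n : ℕ}

/-- The entry of a key in a column; null if it is missing. -/
noncomputable def entry (C : ColumnNF V n) (k : C.Key) (a : Fin n) : Option V :=
  theOption fun v => (k, v) ∈ C.col a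

theorem entry_eq_some_iff (C : ColumnNF V n) {k : C.Key} {a : Fin n} {v : V} :
    C.entry k a = some v ↔ (k, v) ∈ C.col a :=
  theOption_eq_some_iff (C.functional a k)

theorem entry_eq_none_iff (C : ColumnNF V n) {k : C.Key} {a : Fin n} :
    C.entry k a = none ↔ ∀ v, (k, v) ∉ C.col a := by
  simp only [← entry_eq_some_iff, Option.eq_none_iff_forall_ne_some, ne_eq]

theorem fullOuterJoin_eq (C : ColumnNF V n) : C.fullOuterJoin = C.ids.val.map C.entry := rfl

theorem mem_presentRows_iff (C : ColumnNF V n) {r : Fin n → Option V} :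
    r ∈ C.presentRows ↔ r ∈ C.fullOuterJoin ∧ ∀ a, r a ≠ none := by
  simp only [presentRows, fullOuterJoin_eq, Multiset.mem_map, Finset.mem_val, Set.mem_ofPred_eq,
    ← entry_eq_some_iff]
  constructor
  · rintro ⟨k, hk, h⟩
    refine ⟨⟨k, hk, funext fun a => ?_⟩, fun a => ?_⟩ <;> obtain ⟨v, h1, h2⟩ := h a
    · rw [h1, h2]
    · simp [h2]
  · rintro ⟨⟨k, hk, rfl⟩, h⟩
    refine ⟨k, hk, fun a => ?_⟩
    obtain ⟨v, hv⟩ := Option.ne_none_iff_exists'.1 (h a)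
    exact ⟨v, hv, hv⟩

theorem complete_iff (C : ColumnNF V n) :
    C.Complete ↔ ∀ k ∈ C.ids, ∀ a, C.entry k a ≠ none := by
  simp only [Complete, ← entry_eq_some_iff, Option.ne_none_iff_exists']

theorem Complete.presentRows_eq {C : ColumnNF V n} (h : C.Complete) :
    C.presentRows = {r | r ∈ C.fullOuterJoin} := by
  ext r
  rw [mem_presentRows_iff, Set.mem_ofPred_eq, and_iff_left_iff_imp]
  rw [fullOuterJoin_eq, Multiset.mem_map]
  rintro ⟨k, hk, rfl⟩
  exact C.complete_iff.1 h k hk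

/-- `normalize` numbers the rows in the arbitrary order chosen by `toList`. Once the keys are listed
in a matching order, the renaming sends a position to the key at that position. -/
theorem normalize_fullOuterJoin_same (C : ColumnNF V n) : (normalize C.fullOuterJoin).Same C := by
  obtain ⟨l, hl⟩ : ∃ l : List C.Key, (l : Multiset C.Key) = C.ids.val := ⟨_, C.ids.val.coe_toList⟩
  have hnd : l.Nodup := by
    rw [← Multiset.coe_nodup, hl]
    exact C.ids.nodup
  have hperm : (C.fullOuterJoin.toList).Perm (l.map C.entry) := by
    rw [← Multiset.coe_eq_coe, Multiset.coe_toList, fullOuterJoin_eq, ← hl]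
    rfl
  -- Equal rows may belong to different keys, so a row does not identify its key; instead the
  -- permutation of the rows is lifted to a permutation of the keys.
  obtain ⟨l', hl', he⟩ : ∃ l' : List C.Key, l'.Perm l ∧
      l'.map C.entry = C.fullOuterJoin.toList := by
    obtain ⟨l', h, h'⟩ := (congrFun₂ (List.eq_map_comp_perm C.entry) _ _).mpr hperm
    exact ⟨l', h', h.symm⟩
  have hlen : C.fullOuterJoin.toList.length = l'.length := by rw [← he, List.length_map]
  have hmem : ∀ k, k ∈ l' ↔ k ∈ C.ids := fun k => by
    rw [hl'.mem_iff, ← Finset.mem_val, ← hl, Multiset.mem_coe]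
  have hget : ∀ i : Fin C.fullOuterJoin.toList.length,
      C.fullOuterJoin.toList.get i = C.entry (l'.get (Fin.cast hlen i)) := by
    intro i
    rw [List.get_eq_getElem, List.get_eq_getElem]
    simp only [← he, List.getElem_map]
    rfl
  refine ⟨fun i => l'.get (Fin.cast hlen i), ⟨?_, ?_, ?_⟩, ?_⟩
  · intro i _
    exact (hmem _).1 (List.get_mem ..)
  · intro i _ i' _ h
    have := (hl'.nodup_iff.2 hnd).injective_get h
    exact Fin.cast_injective hlen this
  · intro k hk
    obtain ⟨i, hi⟩ := List.mem_iff_get.1 ((hmem k).2 hk)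
    exact ⟨Fin.cast hlen.symm i, Finset.mem_coe.2 (Finset.mem_univ (α := Fin _) _), hi⟩
  · intro a i _ v
    exact (Eq.congr_left (congrFun (hget i) a)).trans C.entry_eq_some_iff

end ColumnNF
/-! ## Expanded queries in terms of full outer joins -/

section Selection

variable {S : Dialect} {m s : ℕ} {ks : Fin m → ℕ} {ws : Fin s → ℕ}

/-- The entries of the chosen keys, with nulls for the missing ones. -/
noncomputable def keyRow (C : ∀ i, ColumnNF S.Val (ks i)) (κ : ∀ i, (C i).Key) (a : Attr ks) :
    Option S.Val :=
  (C a.1).entry (κ a.1) a.2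

/-- The choice `κ` of keys gives a row of the expanded query using the attributes `U`. -/
def Selected (C : ∀ i, ColumnNF S.Val (ks i)) (sub : ∀ j, ColumnNF S.Val (ws j))
    (φ : Formula S (Attr ks) ws) (U : Set (Attr ks)) (κ : ∀ i, (C i).Key) : Prop :=
  (∀ i, κ i ∈ (C i).ids) ∧ (∀ a ∈ φ.attrs ∪ U, keyRow C κ a ≠ none) ∧
    φ.eval (fun j => (sub j).presentRows) (fun a => keyRow C κ a = none) (keyRow C κ) = Truth.t

/-- The choices of keys that give a row of the expanded query using the attributes `U`. -/
noncomputable def selection (C : ∀ i, ColumnNF S.Val (ks i)) (sub : ∀ j, ColumnNF S.Val (ws j))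
    (φ : Formula S (Attr ks) ws) (U : Set (Attr ks)) : Finset (∀ i, (C i).Key) :=
  (Fintype.piFinset fun i => (C i).ids).filter (Selected C sub φ U)

variable {C : ∀ i, ColumnNF S.Val (ks i)} {sub : ∀ j, ColumnNF S.Val (ws j)}
  {φ : Formula S (Attr ks) ws} {U : Set (Attr ks)} {κ : ∀ i, (C i).Key}

theorem mem_selection : κ ∈ selection C sub φ U ↔ Selected C sub φ U κ := by
  rw [selection, Finset.mem_filter, Fintype.mem_piFinset, and_iff_right_iff_imp]
  exact fun h => h.1

theorem joined_iff {ρ : Attr ks → Option S.Val} :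
    Joined C U κ ρ ↔ ∀ a ∈ U, keyRow C κ a ≠ none ∧ ρ a = keyRow C κ a := by
  refine forall₂_congr fun a _ => ?_
  simp only [← ColumnNF.entry_eq_some_iff]
  constructor
  · rintro ⟨x, h, h'⟩
    exact ⟨by simp [keyRow, h], h'.trans h.symm⟩
  · rintro ⟨h, h'⟩
    obtain ⟨x, hx⟩ := Option.ne_none_iff_exists'.1 h
    exact ⟨x, hx, h'.trans hx⟩

/-- Separates a condition on the keys alone from the fact that the joins force `ρ` on the attributes
in use. -/
theorem expandedWhere_iff {ρ : Attr ks → Option S.Val} :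
    ExpandedWhere C sub φ U κ ρ ↔
      Selected C sub φ U κ ∧ ∀ a ∈ φ.attrs ∪ U, ρ a = keyRow C κ a := by
  have hmiss : (fun a : Attr ks => ∀ x, (κ a.1, x) ∉ (C a.1).col a.2) =
      fun a => keyRow C κ a = none := by
    funext a
    rw [keyRow, ColumnNF.entry_eq_none_iff]
  rw [ExpandedWhere, joined_iff, hmiss, Selected, forall₂_and]
  constructor
  · rintro ⟨h1, ⟨h2, h3⟩, h4⟩
    rw [φ.eval_congr _ _ fun a ha => h3 a (Or.inl ha)] at h4
    exact ⟨⟨h1, h2, h4⟩, h3⟩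
  · rintro ⟨⟨h1, h2, h4⟩, h3⟩
    rw [← φ.eval_congr _ _ fun a ha => h3 a (Or.inl ha)] at h4
    exact ⟨h1, ⟨h2, h3⟩, h4⟩

theorem Selected.expandedWhere (h : Selected C sub φ U κ) :
    ExpandedWhere C sub φ U κ (keyRow C κ) :=
  expandedWhere_iff.2 ⟨h, fun _ _ => rfl⟩

theorem exists_expandedWhere_iff : (∃ ρ, ExpandedWhere C sub φ U κ ρ) ↔ Selected C sub φ U κ :=
  ⟨fun ⟨_, h⟩ => (expandedWhere_iff.1 h).1, fun h => ⟨_, h.expandedWhere⟩⟩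

/-- The truth of `φ` does not involve `U'`, so further attributes only add presence conditions. This
is how the expanded query of a column is compared with that of the key relation. -/
theorem selected_union_iff {U' : Set (Attr ks)} :
    Selected C sub φ (U ∪ U') κ ↔ Selected C sub φ U κ ∧ ∀ a ∈ U', keyRow C κ a ≠ none := by
  simp only [Selected, Set.mem_union, or_imp, forall_and]
  tauto

/-- The standard `WHERE` clause `φ'` filters like the expanded clause. -/
theorem standardRows_eq_selection {s' : ℕ} {ws' : Fin s' → ℕ} {T : ∀ i, Table S.Val (ks i)}
    (hT : ∀ i, T i = (C i).fullOuterJoin) (sub' : ∀ j, Table S.Val (ws' j))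
    (φ' : Formula S (Attr ks) ws')
    (h : ∀ κ : ∀ i, (C i).Key, (∀ i, κ i ∈ (C i).ids) →
      (φ'.eval (fun j => {r | r ∈ sub' j}) (fun a => keyRow C κ a = none) (keyRow C κ) = Truth.t ↔
        Selected C sub φ U κ)) :
    standardRows T sub' φ' = (selection C sub φ U).val.map (keyRow C) := by
  obtain rfl : T = fun i => (C i).ids.val.map (C i).entry := funext hT
  rw [standardRows_map]
  refine congrArg (fun s : Finset _ => s.val.map (keyRow C)) (Finset.filter_congr fun κ hκ => ?_)
  exact h κ (Fintype.mem_piFinset.1 hκ)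

theorem columnarSelect_ids {n : ℕ} (out : Fin n → Expression S (Attr ks)) :
    (columnarSelect C sub φ out).ids = selection C sub φ ∅ :=
  Finset.filter_congr fun _ _ => exists_expandedWhere_iff

theorem columnarSelect_entry {n : ℕ} (out : Fin n → Expression S (Attr ks))
    (h : Selected C sub φ ∅ κ) (c : Fin n) :
    (columnarSelect C sub φ out).entry κ c = (out c).eval (keyRow C κ) := by
  refine theOption_eq fun x => ⟨?_, fun hx => ?_⟩
  · rintro ⟨ρ, hρ, hx⟩
    rw [← (out c).eval_congr fun a ha => (expandedWhere_iff.1 hρ).2 a (Or.inr ha)]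
    exact hx
  · have hne := (out c).eval_ne_none_iff.1 (hx.trans_ne (Option.some_ne_none x))
    refine ⟨keyRow C κ, Selected.expandedWhere ?_, hx⟩
    rw [← Set.empty_union (out c).attrs]
    exact selected_union_iff.2 ⟨h, hne⟩

theorem columnarSelect_fullOuterJoin {n : ℕ} (out : Fin n → Expression S (Attr ks)) :
    (columnarSelect C sub φ out).fullOuterJoin =
      (selection C sub φ ∅).val.map fun κ c => (out c).eval (keyRow C κ) := by
  rw [ColumnNF.fullOuterJoin_eq, columnarSelect_ids]
  refine Multiset.map_congr rfl fun κ hκ => ?_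
  exact funext (columnarSelect_entry out (mem_selection.1 hκ))

/-! ### Grouping -/

variable {g : ℕ} {v : Fin g → Attr ks}

theorem mem_groupKeys {w : Fin g → S.Val} : w ∈ groupKeys C sub φ v ↔
    ∃ κ, Selected C sub φ (Set.range v) κ ∧ ∀ i, keyRow C κ (v i) = some (w i) := by
  constructor
  · rintro ⟨κ, ρ, h, hw⟩
    refine ⟨κ, (expandedWhere_iff.1 h).1, fun i => ?_⟩
    rw [← hw, (expandedWhere_iff.1 h).2 _ (Or.inr (Set.mem_range_self i))]
  · rintro ⟨κ, h, hw⟩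
    exact ⟨κ, _, h.expandedWhere, hw⟩

/-- Grouping attributes are present on every selected row, so the distinct grouping tuples are
null-free and correspond to the columnar group keys. -/
theorem map_selection_dedup :
    ((selection C sub φ (Set.range v)).val.map fun κ i => keyRow C κ (v i)).dedup =
      (groupKeys_finite C sub φ v).toFinset.val.map fun w i => some (w i) := by
  refine (Multiset.Nodup.ext (Multiset.nodup_dedup _) (Multiset.Nodup.map ?_ ?_)).2 fun r => ?_
  · exact fun w w' h => funext fun i => Option.some.inj (congrFun h i)
  · exact Finset.nodup _
  · simp only [Multiset.mem_dedup, Multiset.mem_map, Finset.mem_val, mem_selection,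
      Set.Finite.mem_toFinset, mem_groupKeys]
    constructor
    · rintro ⟨κ, h, rfl⟩
      have : ∀ i, ∃ x, keyRow C κ (v i) = some x := fun i =>
        Option.ne_none_iff_exists'.1 (h.2.1 _ (Or.inr (Set.mem_range_self i)))
      choose w hw using this
      exact ⟨w, ⟨κ, h, hw⟩, funext fun i => (hw i).symm⟩
    · rintro ⟨w, ⟨κ, h, hw⟩, rfl⟩
      exact ⟨κ, h, funext hw⟩

theorem groupRow_iff {e : Expression S (Attr ks)} {w : Fin g → S.Val} {x : S.Val} :
    GroupRow C sub φ v e w κ x ↔ (Selected C sub φ (Set.range v) κ ∧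
      (fun i => keyRow C κ (v i)) = fun i => some (w i)) ∧ e.eval (keyRow C κ) = some x := by
  constructor
  · rintro ⟨ρ, h, hw, hx⟩
    obtain ⟨hs, hρ⟩ := expandedWhere_iff.1 h
    refine ⟨⟨(selected_union_iff.1 hs).1, funext fun i => ?_⟩, ?_⟩
    · rw [← hw, hρ _ (Or.inr (Or.inl (Set.mem_range_self i)))]
    · rw [← hx, e.eval_congr fun a ha => hρ a (Or.inr (Or.inr ha))]
  · rintro ⟨⟨h, hw⟩, hx⟩
    refine ⟨keyRow C κ, Selected.expandedWhere (selected_union_iff.2 ⟨h, ?_⟩), congrFun hw, hx⟩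
    exact e.eval_ne_none_iff.1 (hx.trans_ne (Option.some_ne_none x))

/-- The joins for `e` discard exactly the rows of the group on which `e` is null; `filterMap id`
does the same. -/
theorem groupBag_eq (e : Expression S (Attr ks)) (w : Fin g → S.Val) :
    groupBag C sub φ v e w = (((selection C sub φ (Set.range v)).val.filter fun κ =>
      (fun i => keyRow C κ (v i)) = fun i => some (w i)).map
        fun κ => e.eval (keyRow C κ)).filterMap id := by
  rw [groupBag, selection, Finset.filter_val, Multiset.filter_filter, Multiset.filterMap_map,
    Multiset.filterMap_filter]
  refine congrArg (Multiset.filterMap · _) (funext fun κ => theOption_eq fun x => ?_)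
  rw [groupRow_iff]
  split_ifs with h
  · simp [h.1, h.2]
  · simp only [iff_false, not_and]
    exact fun h' => (h ⟨h'.2, h'.1⟩).elim

/-- The aggregate of the values that are present; null if there is none. -/
noncomputable def aggregatePresent (γ : S.Agg) (b : Multiset (Option S.Val)) : Option S.Val :=
  if b.filterMap id = 0 then none else some (S.agg γ (b.filterMap id))

/-- Entry of an output column of a grouping query. -/
noncomputable def groupEntry (C : ∀ i, ColumnNF S.Val (ks i)) (sub : ∀ j, ColumnNF S.Val (ws j))
    (φ : Formula S (Attr ks) ws) (v : Fin g → Attr ks) (w : Fin g → S.Val) :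
    GroupColumn S (Attr ks) g → Option S.Val
  | .key e => e.eval fun i => some (w i)
  | .agg γ e => aggregatePresent γ (((selection C sub φ (Set.range v)).val.filter fun κ =>
      (fun i => keyRow C κ (v i)) = fun i => some (w i)).map fun κ => e.eval (keyRow C κ))

theorem columnarGroup_entry {n : ℕ} (out : Fin n → GroupColumn S (Attr ks) g)
    {w : Fin g → S.Val} (hw : w ∈ groupKeys C sub φ v) (c : Fin n) :
    (columnarGroup C sub φ v out).entry w c = groupEntry C sub φ v w (out c) := by
  refine theOption_eq fun x => ?_
  change (w, x) ∈ groupColumn C sub φ v (out c) ↔ _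
  cases out c with
  | key e => exact and_iff_right hw
  | agg γ e =>
    rw [groupEntry, aggregatePresent, ← groupBag_eq]
    change (groupBag C sub φ v e w ≠ 0 ∧ x = S.agg γ (groupBag C sub φ v e w)) ↔ _
    split_ifs with h
    · simp [h]
    · simp [h, eq_comm]

theorem columnarGroup_fullOuterJoin {n : ℕ} (out : Fin n → GroupColumn S (Attr ks) g) :
    (columnarGroup C sub φ v out).fullOuterJoin =
      (groupKeys_finite C sub φ v).toFinset.val.map
        fun w c => groupEntry C sub φ v w (out c) := by
  rw [ColumnNF.fullOuterJoin_eq]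
  refine Multiset.map_congr rfl fun w hw => ?_
  exact funext (columnarGroup_entry out ((Set.Finite.mem_toFinset _).1 hw))

end Selection
/-! ## Standard queries -/

/-! ### Aggregates that skip nulls; `IN` without nulls -/

section Aggregate

variable {S : Dialect}

theorem aggregate_map_of_ne_none {ι : Type*} (γ : S.Agg) {K : Multiset ι} {x : ι → Option S.Val}
    (h : ∀ k ∈ K, x k ≠ none) :
    aggregate γ (K.map x) = some (S.agg γ ((K.map x).filterMap id)) := by
  refine if_neg fun hn => ?_
  obtain ⟨k, hk, hx⟩ := Multiset.mem_map.1 hn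
  exact h k hk hx

theorem filterMap_id_map_eq_zero_iff {ι : Type*} {K : Multiset ι} {x : ι → Option S.Val} :
    (K.map x).filterMap id = 0 ↔ ∀ k ∈ K, x k = none := by
  simp [Multiset.eq_zero_iff_forall_notMem, Option.eq_none_iff_forall_ne_some]
  exact ⟨fun h k hk a ha => h a k hk ha, fun h a k hk ha => h k hk a ha⟩

theorem filterMap_id_map_filter {ι : Type*} (K : Multiset ι) (x : ι → Option S.Val) :
    ((K.filter fun k => x k ≠ none).map x).filterMap id = (K.map x).filterMap id := by
  rw [Multiset.filterMap_map, Multiset.filterMap_map, Multiset.filterMap_filter]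
  refine congrArg (Multiset.filterMap · _) (funext fun k => ?_)
  by_cases h : x k = none <;> simp [h]

/-- The standard aggregate of the values that are present, or of all values if none is present,
skips nulls. -/
theorem aggregate_filter_eq_aggregatePresent {ι : Type*} (γ : S.Agg) {K : Multiset ι}
    (hK : K ≠ 0) (x : ι → Option S.Val) :
    aggregate γ ((K.filter fun k => x k ≠ none ∨ ∀ l ∈ K, x l = none).map x) =
      aggregatePresent γ (K.map x) := by
  rw [aggregatePresent]
  split_ifs with h
  · rw [filterMap_id_map_eq_zero_iff] at h
    obtain ⟨k, hk⟩ := Multiset.exists_mem_of_ne_zero hK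
    refine if_pos (Multiset.mem_map.2 ⟨k, Multiset.mem_filter.2 ⟨hk, Or.inr h⟩, h k hk⟩)
  · rw [filterMap_id_map_eq_zero_iff] at h
    simp only [h, or_false]
    rw [aggregate_map_of_ne_none γ fun k hk => (Multiset.mem_filter.1 hk).2,
      filterMap_id_map_filter]

/-- The two differ on the empty bag, where only `aggregatePresent` is null; hence `hK`. -/
theorem aggregatePresent_of_ne_none {ι : Type*} (γ : S.Agg) {K : Multiset ι} (hK : K ≠ 0)
    {x : ι → Option S.Val} (h : ∀ k ∈ K, x k ≠ none) :
    aggregatePresent γ (K.map x) = aggregate γ (K.map x) := by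
  rw [aggregate_map_of_ne_none γ h, aggregatePresent, if_neg]
  rw [filterMap_id_map_eq_zero_iff]
  obtain ⟨k, hk⟩ := Multiset.exists_mem_of_ne_zero hK
  exact fun h' => h k hk (h' k hk)

/-- Without nulls all comparisons are two-valued, so `IN` is plain membership and can safely be
negated. -/
theorem sup_inf_eq {k : ℕ} {rows : Set (Fin k → Option S.Val)} {u : Fin k → Option S.Val}
    (hrows : ∀ r ∈ rows, ∀ c, r c ≠ none) (hu : ∀ c, u c ≠ none) :
    Truth.sup ((fun r => Truth.inf (Set.range fun c => Pred.eq.eval ![u c, r c])) '' rows) =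
      Truth.ofProp (u ∈ rows) := by
  have h : ∀ r ∈ rows, Truth.inf (Set.range fun c => Pred.eq.eval ![u c, r c]) =
      Truth.ofProp (r = u) := by
    intro r hr
    have : ∀ c, Pred.eq.eval ![u c, r c] = Truth.ofProp (r c = u c) := by
      intro c
      obtain ⟨x, hx⟩ := Option.ne_none_iff_exists'.1 (hu c)
      obtain ⟨y, hy⟩ := Option.ne_none_iff_exists'.1 (hrows r hr c)
      rw [hx, hy, Pred.eval_eq_some_some]
      simp [eq_comm]
    simp only [this, Truth.inf_range_ofProp, funext_iff]
  rw [Set.image_congr h, Truth.sup_ofProp]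
  simp

end Aggregate

theorem standardRows_single {S : Dialect} {k s : ℕ} {ws : Fin s → ℕ} {ι : Type}
    (K : Multiset ι) (f : ι → Fin k → Option S.Val) (sub : ∀ j, Table S.Val (ws j))
    (φ : Formula S (Attr fun _ : Fin 1 => k) ws) :
    standardRows (fun _ : Fin 1 => K.map f) sub φ =
      (K.filter fun κ => φ.eval (fun j => {r | r ∈ sub j})
        (fun a => f κ a.2 = none) (fun a => f κ a.2) = Truth.t).map fun κ a => f κ a.2 := by
  have h : (bagProduct fun _ : Fin 1 => K.map f) = K.map fun κ _ => f κ := by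
    simp only [bagProduct, Multiset.map_singleton, Multiset.bind_singleton, Multiset.map_map]
    refine Multiset.map_congr rfl fun κ _ => funext fun i => ?_
    obtain rfl : i = 0 := Subsingleton.elim (α := Fin 1) i 0
    rfl
  rw [standardRows, h, Multiset.map_map, Multiset.filter_map]
  rfl

/-! ### Null filtering, aggregation and joins as standard queries -/

namespace Query

variable {S : Dialect} {D : Schema}

/-- `SELECT * FROM Q WHERE` all columns are `NOT NULL`. -/
noncomputable def presentRows {k : ℕ} (Q : Query S D k) : Query S D k :=
  .select (ks := fun _ : Fin 1 => k) (ws := fun j : Fin 0 => j.elim0) (fun _ => Q)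
    (fun j => j.elim0) (.present Set.univ) fun c => .attr ⟨0, c⟩

theorem noMissing_presentRows {k : ℕ} {Q : Query S D k} (h : Q.NoMissing) :
    Q.presentRows.NoMissing :=
  ⟨fun _ => h, fun j => j.elim0, Formula.noMissing_present _⟩

theorem mem_evalStandard_presentRows (I : Instance S D) {k : ℕ} {Q : Query S D k}
    {r : Fin k → Option S.Val} : r ∈ Q.presentRows.evalStandard I ↔
      r ∈ Q.evalStandard I ∧ ∀ c, r c ≠ none := by
  have h : Q.presentRows.evalStandard I =
      (Q.evalStandard I).filter fun r => ∀ c, r c ≠ none := by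
    have h' := standardRows_single (Q.evalStandard I) id
      (fun j : Fin 0 => Query.evalStandard I (D := D) (n := j.elim0) j.elim0)
      (Formula.present Set.univ)
    rw [Multiset.map_id] at h'
    rw [presentRows, evalStandard, h', Multiset.map_map]
    simp only [Formula.eval_present_eq_t]
    refine (Multiset.map_id' _).trans (Multiset.filter_congr fun r _ => ?_)
    exact ⟨fun h c => h ⟨0, c⟩ trivial, fun h a _ => h a.2⟩
  rw [h, Multiset.mem_filter]

/-- Groups the query `T` by all columns but the first, and aggregates the values present in the
first column of each group; if there is none, then the aggregate is null. -/
noncomputable def aggregatePresent {g : ℕ} (T : Query S D (g + 1)) (γ : S.Agg) :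
    Query S D (g + 1) :=
  .group (ks := fun _ : Fin 1 => g + 1) (ws := fun _ : Fin 1 => g) (fun _ => T)
    (fun _ => .select (ks := fun _ : Fin 1 => g + 1) (ws := fun j : Fin 0 => j.elim0) (fun _ => T)
      (fun j => j.elim0) (.not (.isNull (.attr ⟨0, 0⟩))) fun i => .attr ⟨0, i.succ⟩)
    (.or (.not (.isNull (.attr ⟨0, 0⟩))) (.not (.isIn 0 fun i => .attr ⟨0, i.succ⟩)))
    (fun i => ⟨0, i.succ⟩)
    (Fin.cons (.agg γ (.attr ⟨0, 0⟩)) fun i => .key (.attr i))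

theorem noMissing_aggregatePresent {g : ℕ} {T : Query S D (g + 1)} (h : T.NoMissing) (γ : S.Agg) :
    (T.aggregatePresent γ).NoMissing :=
  ⟨fun _ => h, fun _ => ⟨fun _ => h, fun j => j.elim0, trivial⟩, trivial, trivial⟩

/-- Keeping only rows with a value would lose the groups that have none. The `NOT IN` disjunct
retains exactly those groups, whose inputs are all null, so that the standard aggregate gives null
on them. The assumption `hw` makes `NOT IN` two-valued. -/
theorem evalStandard_aggregatePresent (I : Instance S D) {g : ℕ} {T : Query S D (g + 1)}
    (γ : S.Agg) {ι : Type} {K : Multiset ι} {x : ι → Option S.Val} {w : ι → Fin g → Option S.Val}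
    (hT : T.evalStandard I = K.map fun κ => Fin.cons (x κ) (w κ))
    (hw : ∀ κ ∈ K, ∀ i, w κ i ≠ none) :
    (T.aggregatePresent γ).evalStandard I = (K.map w).dedup.map fun u =>
      Fin.cons (SQL.aggregatePresent γ ((K.filter fun κ => w κ = u).map x)) u := by
  rw [aggregatePresent, evalStandard]
  simp only [evalStandard]
  rw [hT]
  simp only [standardRows_single, Formula.eval, Expression.eval, Truth.not_ofProp,
    Truth.ofProp_eq_t, Fin.cons_zero, Fin.cons_succ, Truth.or_eq_t, Multiset.map_map,
    Function.comp_def]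
  have hrows : ∀ r ∈ {r | r ∈ (K.filter fun κ => ¬ x κ = none).map w}, ∀ c, r c ≠ none := by
    intro r hr
    obtain ⟨κ, hκ, rfl⟩ := Multiset.mem_map.1 hr
    exact hw κ (Multiset.mem_filter.1 hκ).1
  -- The subquery lists the keys of groups with a value, so `NOT IN` says that the group of `κ` has
  -- none.
  have hF : (K.filter fun κ => ¬ x κ = none ∨ (Truth.sup ((fun r => Truth.inf (Set.range fun c =>
      Pred.eq.eval ![w κ c, r c])) '' {r | r ∈ (K.filter fun κ => ¬ x κ = none).map w})).not =
        Truth.t) =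
      K.filter fun κ => x κ ≠ none ∨ ∀ l ∈ K.filter (fun l => w l = w κ), x l = none := by
    refine Multiset.filter_congr fun κ hκ => ?_
    rw [sup_inf_eq hrows (hw κ hκ), Truth.not_ofProp, Truth.ofProp_eq_t]
    refine or_congr_right ?_
    simp only [Set.mem_ofPred_eq, Multiset.mem_map, Multiset.mem_filter]
    constructor
    · rintro h l ⟨hl, e⟩
      by_contra hx
      exact h ⟨l, ⟨hl, hx⟩, e⟩
    · rintro h ⟨l, ⟨hl, hx⟩, e⟩
      exact hx (h l ⟨hl, e⟩)
  rw [hF]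
  -- No group is lost: a group survives through a member with a value or, if there is none, through
  -- all its members.
  have hdedup : ((K.filter fun κ => x κ ≠ none ∨
      ∀ l ∈ K.filter (fun l => w l = w κ), x l = none).map w).dedup = (K.map w).dedup := by
    refine (Multiset.Nodup.ext (Multiset.nodup_dedup _) (Multiset.nodup_dedup _)).2 fun u => ?_
    simp only [Multiset.mem_dedup, Multiset.mem_map, Multiset.mem_filter]
    constructor
    · rintro ⟨κ, ⟨hκ, -⟩, rfl⟩
      exact ⟨κ, hκ, rfl⟩
    · rintro ⟨κ, hκ, rfl⟩
      by_cases h : ∃ l ∈ K, w l = w κ ∧ x l ≠ none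
      · obtain ⟨l, hl, e, hx⟩ := h
        exact ⟨l, ⟨hl, Or.inl hx⟩, e⟩
      · push Not at h
        exact ⟨κ, ⟨hκ, Or.inr fun l hl => h l hl.1 hl.2⟩, rfl⟩
  refine Eq.trans ?_ (congrArg _ hdedup)
  refine Multiset.map_congr (by congr) fun u hu => ?_
  refine funext fun c => Fin.cases ?_ (fun i => ?_) c
  · simp only [Fin.cons_zero]
    obtain ⟨κ, hκ, rfl⟩ := Multiset.mem_map.1 (Multiset.mem_dedup.1 (hdedup ▸ hu))
    have hne : K.filter (fun l => w l = w κ) ≠ 0 := fun h =>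
      Multiset.notMem_zero κ (h ▸ Multiset.mem_filter.2 ⟨hκ, rfl⟩)
    rw [← aggregate_filter_eq_aggregatePresent γ hne x]
    congr 1
    rw [Multiset.filter_map, Multiset.map_map, Multiset.filter_filter, Multiset.filter_filter]
    refine Multiset.map_congr (Multiset.filter_congr fun l _ => ?_) fun _ _ => rfl
    simp only [Function.comp, Fin.cons_succ]
    refine and_comm.trans (and_congr_left fun e => ?_)
    rw [show w l = w κ from e]
  · simp [Expression.eval]

/-- Joins queries on all columns but the first, and selects the first columns. -/
noncomputable def joinOnTail {g n : ℕ} (q : Fin (n + 1) → Query S D (g + 1)) :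
    Query S D (n + 1) :=
  .select (ks := fun _ => g + 1) (ws := fun j : Fin 0 => j.elim0) q (fun j => j.elim0)
    (.conj ((Finset.univ : Finset (Fin (n + 1) × Fin g)).toList.map fun p =>
      .pred .eq fun i => .attr (![⟨p.1, p.2.succ⟩, ⟨0, p.2.succ⟩] i)))
    fun c => .attr ⟨c, 0⟩

theorem noMissing_joinOnTail {g n : ℕ} {q : Fin (n + 1) → Query S D (g + 1)}
    (h : ∀ c, (q c).NoMissing) : (joinOnTail q).NoMissing := by
  refine ⟨h, fun j => j.elim0, Formula.noMissing_conj fun φ hφ => ?_⟩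
  obtain ⟨p, -, rfl⟩ := List.mem_map.1 hφ
  trivial

/-- Each key occurs once in each `q c` and is null-free, so the join leaves one combination for each
key, with the right multiplicity. Column 0 serves as the reference for the equalities, hence `n +
1`. -/
theorem evalStandard_joinOnTail (I : Instance S D) {g n : ℕ}
    {q : Fin (n + 1) → Query S D (g + 1)} {G : Finset (Fin g → S.Val)}
    {f : Fin (n + 1) → (Fin g → S.Val) → Option S.Val}
    (h : ∀ c, (q c).evalStandard I = G.val.map fun w => Fin.cons (f c w) fun i => some (w i)) :
    (joinOnTail q).evalStandard I = G.val.map fun w c => f c w := by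
  rw [joinOnTail, evalStandard]
  simp only [h]
  rw [standardRows_map, Multiset.map_map]
  -- The surviving families of keys are the constant ones.
  have hG : ((Fintype.piFinset fun _ : Fin (n + 1) => G).filter fun κ => ∀ c, κ c = κ 0).val =
      G.val.map fun w _ => w := by
    refine (Multiset.Nodup.ext (Finset.nodup _) (Multiset.Nodup.map ?_ G.nodup)).2 fun κ => ?_
    · exact fun w w' h => congrFun h 0
    · simp only [Finset.mem_val, Finset.mem_filter, Fintype.mem_piFinset, Multiset.mem_map]
      constructor
      · exact fun h => ⟨κ 0, h.1 0, funext fun c => (h.2 c).symm⟩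
      · rintro ⟨w, hw, rfl⟩
        exact ⟨fun _ => hw, fun _ => rfl⟩
  refine Eq.trans (congrArg _ ((congrArg Finset.val
    (Finset.filter_congr fun κ _ => ?_)).trans hG)) ?_
  · rw [Formula.eval_conj_eq_t]
    simp only [List.mem_map, Finset.mem_toList, Finset.mem_univ, true_and, Prod.exists,
      forall_exists_index]
    have : ∀ (c : Fin (n + 1)) (i : Fin g) (rows miss),
        (Formula.pred (ws := fun j : Fin 0 => j.elim0) Pred.eq fun i' => .attr
          ((![⟨c, i.succ⟩, ⟨0, i.succ⟩] : Fin 2 → Attr fun _ : Fin (n + 1) => g + 1) i')).eval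
          rows miss (fun a => (Fin.cons (f a.1 (κ a.1)) fun i => some (κ a.1 i) :
            Fin (g + 1) → Option S.Val) a.2) = Truth.ofProp (κ c i = κ 0 i) := by
      intro c i rows miss
      rw [← Pred.eval_eq_some_some, Formula.eval]
      congr 1
      funext i'
      fin_cases i' <;> simp [Expression.eval]
    constructor
    · intro h c
      funext i
      have := this c i
      exact Truth.ofProp_eq_t.1 ((this _ _).symm.trans (h _ c i rfl))
    · rintro h _ c i rfl
      rw [this, Truth.ofProp_eq_t, h c]
  · rw [Multiset.map_map]
    rfl

end Query
/-! ## Translation of queries -/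

section Translation

variable {S : Dialect} {D : Schema} {m s : ℕ} {ks : Fin m → ℕ} {ws : Fin s → ℕ}

theorem standardRows_standardize {C : ∀ i, ColumnNF S.Val (ks i)}
    {sub : ∀ j, ColumnNF S.Val (ws j)} (φ : Formula S (Attr ks) ws) (U : Set (Attr ks))
    {T : ∀ i, Table S.Val (ks i)} (hT : ∀ i, T i = (C i).fullOuterJoin)
    {T' : ∀ j, Table S.Val (ws j)} (hT' : ∀ j, {r | r ∈ T' j} = (sub j).presentRows) :
    standardRows T T' (φ.standardize U) = (selection C sub φ U).val.map (keyRow C) := by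
  refine standardRows_eq_selection hT T' _ fun κ hκ => ?_
  rw [Formula.eval_standardize_eq_t, funext hT', Selected, and_iff_right hκ]

/-- All presence conditions hold automatically, for any `U`, and the subqueries have no rows with
nulls to strip; so `φ` needs no rewriting. -/
theorem standardRows_of_complete {C : ∀ i, ColumnNF S.Val (ks i)}
    {sub : ∀ j, ColumnNF S.Val (ws j)} {φ : Formula S (Attr ks) ws} (U : Set (Attr ks))
    (hC : ∀ i, (C i).Complete) (hsub : ∀ j, (sub j).Complete) :
    standardRows (fun i => (C i).fullOuterJoin) (fun j => (sub j).fullOuterJoin) φ =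
      (selection C sub φ U).val.map (keyRow C) := by
  refine standardRows_eq_selection (fun _ => rfl) _ _ fun κ hκ => ?_
  simp only [Selected, (hsub _).presentRows_eq, and_iff_right hκ]
  exact (and_iff_right fun (a : Attr ks) _ => (C a.1).complete_iff.1 (hC a.1) _ (hκ a.1) a.2).symm

namespace Query

/-- The output table of a grouping query, computed from the rows kept by the `WHERE` clause. -/
theorem evalStandard_group (I : Instance S D) {g n : ℕ} (src : ∀ i, Query S D (ks i))
    (sub : ∀ j, Query S D (ws j)) (φ : Formula S (Attr ks) ws) (v : Fin g → Attr ks)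
    (out : Fin n → GroupColumn S (Attr ks) g) {C : ∀ i, ColumnNF S.Val (ks i)}
    {sub' : ∀ j, ColumnNF S.Val (ws j)} {φ' : Formula S (Attr ks) ws}
    (h : standardRows (fun i => (src i).evalStandard I) (fun j => (sub j).evalStandard I) φ =
      (selection C sub' φ' (Set.range v)).val.map (keyRow C)) :
    (Query.group src sub φ v out).evalStandard I =
      (groupKeys_finite C sub' φ' v).toFinset.val.map fun w c =>
        match out c with
        | .key e => e.eval fun i => some (w i)
        | .agg γ e => aggregate γ (((selection C sub' φ' (Set.range v)).val.filter fun κ =>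
            (fun i => keyRow C κ (v i)) = fun i => some (w i)).map
              fun κ => e.eval (keyRow C κ)) := by
  rw [evalStandard, h]
  have h' := map_selection_dedup (C := C) (sub := sub') (φ := φ') (v := v)
  simp only [Multiset.map_map, Function.comp_def, h', Multiset.filter_map]
  refine Multiset.map_congr rfl fun w _ => funext fun c => ?_
  cases out c with
  | key e => rfl
  | agg γ e => congr

/-- The column `o` of a grouping query with groups `v`, followed by the grouping attributes. -/
noncomputable def groupColumnWithKeys {g : ℕ} (src : ∀ i, Query S D (ks i))
    (sub : ∀ j, Query S D (ws j)) (φ : Formula S (Attr ks) ws) (v : Fin g → Attr ks) :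
    GroupColumn S (Attr ks) g → Query S D (g + 1)
  | .key e => .group src sub φ v (Fin.cons (.key e) fun i => .key (.attr i))
  | .agg γ e => (Query.select src sub φ (Fin.cons e fun i => .attr (v i))).aggregatePresent γ

theorem noMissing_groupColumnWithKeys {g : ℕ} {src : ∀ i, Query S D (ks i)}
    {sub : ∀ j, Query S D (ws j)} {φ : Formula S (Attr ks) ws} (v : Fin g → Attr ks)
    (o : GroupColumn S (Attr ks) g) (hsrc : ∀ i, (src i).NoMissing)
    (hsub : ∀ j, (sub j).NoMissing) (hφ : φ.NoMissing) :
    (groupColumnWithKeys src sub φ v o).NoMissing := by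
  cases o with
  | key e => exact ⟨hsrc, hsub, hφ⟩
  | agg γ e =>
    have h : (Query.select src sub φ (Fin.cons e fun i => .attr (v i))).NoMissing :=
      ⟨hsrc, hsub, hφ⟩
    exact noMissing_aggregatePresent h γ

theorem evalStandard_groupColumnWithKeys (I : Instance S D) {g : ℕ}
    {src : ∀ i, Query S D (ks i)} {sub : ∀ j, Query S D (ws j)} {φ : Formula S (Attr ks) ws}
    {v : Fin g → Attr ks} (o : GroupColumn S (Attr ks) g) {C : ∀ i, ColumnNF S.Val (ks i)}
    {sub' : ∀ j, ColumnNF S.Val (ws j)} {φ' : Formula S (Attr ks) ws}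
    (h : standardRows (fun i => (src i).evalStandard I) (fun j => (sub j).evalStandard I) φ =
      (selection C sub' φ' (Set.range v)).val.map (keyRow C)) :
    (groupColumnWithKeys src sub φ v o).evalStandard I =
      (groupKeys_finite C sub' φ' v).toFinset.val.map fun w =>
        Fin.cons (groupEntry C sub' φ' v w o) fun i => some (w i) := by
  cases o with
  | key e =>
    rw [groupColumnWithKeys, evalStandard_group I src sub φ v _ h]
    refine Multiset.map_congr rfl fun w _ => funext fun c => ?_
    exact Fin.cases rfl (fun i => rfl) c
  | agg γ e =>
    have hT : (Query.select src sub φ (Fin.cons e fun i => .attr (v i))).evalStandard I =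
        (selection C sub' φ' (Set.range v)).val.map fun κ =>
          Fin.cons (e.eval (keyRow C κ)) fun i => keyRow C κ (v i) := by
      rw [evalStandard, h, Multiset.map_map]
      refine Multiset.map_congr rfl fun κ _ => funext fun c => ?_
      exact Fin.cases rfl (fun i => rfl) c
    rw [groupColumnWithKeys, evalStandard_aggregatePresent I γ hT, map_selection_dedup,
      Multiset.map_map]
    · rfl
    · exact fun κ hκ i => (mem_selection.1 hκ).2.1 _ (Or.inr (Set.mem_range_self i))

/-- A standard query for a grouping query whose aggregates skip nulls. -/
noncomputable def groupPresent {g : ℕ} (src : ∀ i, Query S D (ks i))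
    (sub : ∀ j, Query S D (ws j)) (φ : Formula S (Attr ks) ws) (v : Fin g → Attr ks) :
    {n : ℕ} → (Fin n → GroupColumn S (Attr ks) g) → Query S D n
  -- With no columns there is nothing to join, and an empty join would give a single row instead of
  -- one for each group. No aggregate occurs, so the plain grouping query is right.
  | 0, out => .group src sub φ v out
  | _ + 1, out => joinOnTail fun c => groupColumnWithKeys src sub φ v (out c)

theorem noMissing_groupPresent {g n : ℕ} {src : ∀ i, Query S D (ks i)}
    {sub : ∀ j, Query S D (ws j)} {φ : Formula S (Attr ks) ws} (v : Fin g → Attr ks)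
    (out : Fin n → GroupColumn S (Attr ks) g) (hsrc : ∀ i, (src i).NoMissing)
    (hsub : ∀ j, (sub j).NoMissing) (hφ : φ.NoMissing) :
    (groupPresent src sub φ v out).NoMissing := by
  cases n with
  | zero => exact ⟨hsrc, hsub, hφ⟩
  | succ n =>
    exact noMissing_joinOnTail fun c => noMissing_groupColumnWithKeys v (out c) hsrc hsub hφ

theorem evalStandard_groupPresent (I : Instance S D) {g n : ℕ}
    {src : ∀ i, Query S D (ks i)} {sub : ∀ j, Query S D (ws j)} {φ : Formula S (Attr ks) ws}
    {v : Fin g → Attr ks} (out : Fin n → GroupColumn S (Attr ks) g)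
    {C : ∀ i, ColumnNF S.Val (ks i)} {sub' : ∀ j, ColumnNF S.Val (ws j)}
    {φ' : Formula S (Attr ks) ws}
    (h : standardRows (fun i => (src i).evalStandard I) (fun j => (sub j).evalStandard I) φ =
      (selection C sub' φ' (Set.range v)).val.map (keyRow C)) :
    (groupPresent src sub φ v out).evalStandard I =
      (columnarGroup C sub' φ' v out).fullOuterJoin := by
  rw [columnarGroup_fullOuterJoin]
  cases n with
  | zero =>
    rw [groupPresent, evalStandard_group I src sub φ v out h]
    exact Multiset.map_congr rfl fun w _ => funext fun c => c.elim0
  | succ n =>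
    exact evalStandard_joinOnTail I fun c => evalStandard_groupColumnWithKeys I (out c) h

/-- A standard query whose result is the full outer join of the columnar result. -/
noncomputable def toStandard : {n : ℕ} → Query S D n → Query S D n
  | _, .table R => .table R
  -- `∅`: rows with a null output entry must stay, since the key relation of the output contains
  -- them.
  | _, .select src sub φ out =>
      .select (fun i => (src i).toStandard) (fun j => (sub j).toStandard.presentRows)
        (φ.standardize ∅) out
  | _, .group src sub φ v out =>
      groupPresent (fun i => (src i).toStandard) (fun j => (sub j).toStandard.presentRows)
        (φ.standardize (Set.range v)) v out

theorem noMissing_toStandard {n : ℕ} (Q : Query S D n) : Q.toStandard.NoMissing := by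
  induction Q with
  | table R => trivial
  | select src sub φ out hsrc hsub =>
    exact ⟨hsrc, fun j => noMissing_presentRows (hsub j), φ.noMissing_standardize ∅⟩
  | group src sub φ v out hsrc hsub =>
    exact noMissing_groupPresent v out hsrc (fun j => noMissing_presentRows (hsub j))
      (φ.noMissing_standardize _)

/-- Equality of bags, with no renaming of keys, is what the induction needs: FROM items enter as
bags, WHERE subqueries only through their sets of null-free rows. -/
theorem evalStandard_toStandard (I : ColumnInstance S D) {n : ℕ} (Q : Query S D n) :
    Q.toStandard.evalStandard I.fullOuterJoin = (Q.evalColumnar I).fullOuterJoin := by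
  have hpresent : ∀ {k : ℕ} {Q : Query S D k},
      Q.toStandard.evalStandard I.fullOuterJoin = (Q.evalColumnar I).fullOuterJoin →
      {r | r ∈ Q.toStandard.presentRows.evalStandard I.fullOuterJoin} =
        (Q.evalColumnar I).presentRows := by
    intro k Q h
    ext r
    rw [Set.mem_ofPred_eq, mem_evalStandard_presentRows, h, ColumnNF.mem_presentRows_iff]
  induction Q with
  | table R => rfl
  | select src sub φ out hsrc hsub =>
    rw [toStandard, evalStandard, evalColumnar,
      standardRows_standardize φ ∅ hsrc fun j => hpresent (hsub j), Multiset.map_map,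
      columnarSelect_fullOuterJoin]
    rfl
  | group src sub φ v out hsrc hsub =>
    exact evalStandard_groupPresent _ out
      (standardRows_standardize φ _ hsrc fun j => hpresent (hsub j))

/-! ## Complete instances -/

theorem complete_columnarSelect {C : ∀ i, ColumnNF S.Val (ks i)}
    {sub : ∀ j, ColumnNF S.Val (ws j)} {φ : Formula S (Attr ks) ws} {n : ℕ}
    (out : Fin n → Expression S (Attr ks)) (hC : ∀ i, (C i).Complete) :
    (columnarSelect C sub φ out).Complete := by
  rw [ColumnNF.complete_iff]
  intro κ hκ c
  rw [columnarSelect_ids] at hκ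
  have h := mem_selection.1 hκ
  rw [columnarSelect_entry out h, Expression.eval_ne_none_iff]
  exact fun a _ => (C a.1).complete_iff.1 (hC a.1) _ (h.1 a.1) a.2

/-- A group key comes from some selected row, so the group is non-empty, and completeness excludes
nulls; skipping nulls then changes nothing. -/
theorem groupEntry_agg_of_complete {C : ∀ i, ColumnNF S.Val (ks i)}
    {sub : ∀ j, ColumnNF S.Val (ws j)} {φ : Formula S (Attr ks) ws} {g : ℕ} {v : Fin g → Attr ks}
    (hC : ∀ i, (C i).Complete) (γ : S.Agg) (e : Expression S (Attr ks)) {w : Fin g → S.Val}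
    (hw : w ∈ groupKeys C sub φ v) :
    groupEntry C sub φ v w (.agg γ e) =
      aggregate γ (((selection C sub φ (Set.range v)).val.filter fun κ =>
        (fun i => keyRow C κ (v i)) = fun i => some (w i)).map fun κ => e.eval (keyRow C κ)) := by
  refine aggregatePresent_of_ne_none γ ?_ fun κ hκ => ?_
  · obtain ⟨κ, hκ, h⟩ := mem_groupKeys.1 hw
    exact fun h0 => Multiset.notMem_zero κ
      (h0 ▸ Multiset.mem_filter.2 ⟨mem_selection.2 hκ, funext h⟩)
  · rw [Expression.eval_ne_none_iff]
    intro a _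
    have := (mem_selection.1 (Multiset.mem_filter.1 hκ).1).1
    exact (C a.1).complete_iff.1 (hC a.1) _ (this a.1) a.2

theorem complete_columnarGroup {C : ∀ i, ColumnNF S.Val (ks i)}
    {sub : ∀ j, ColumnNF S.Val (ws j)} {φ : Formula S (Attr ks) ws} {g n : ℕ}
    (v : Fin g → Attr ks) (out : Fin n → GroupColumn S (Attr ks) g) (hC : ∀ i, (C i).Complete) :
    (columnarGroup C sub φ v out).Complete := by
  rw [ColumnNF.complete_iff]
  intro w hw c
  have hw' : w ∈ groupKeys C sub φ v := (Set.Finite.mem_toFinset _).1 hw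
  rw [columnarGroup_entry out hw']
  cases out c with
  | key e => exact e.eval_ne_none_iff.2 fun _ _ => Option.some_ne_none _
  | agg γ e =>
    rw [groupEntry_agg_of_complete hC γ e hw', aggregate_map_of_ne_none]
    · exact Option.some_ne_none _
    · intro κ hκ
      rw [Expression.eval_ne_none_iff]
      intro a _
      have := (mem_selection.1 (Multiset.mem_filter.1 hκ).1).1
      exact (C a.1).complete_iff.1 (hC a.1) _ (this a.1) a.2

theorem complete_evalColumnar {I : ColumnInstance S D} (hI : I.Complete) {n : ℕ}
    (Q : Query S D n) : (Q.evalColumnar I).Complete := by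
  induction Q with
  | table R => exact hI R
  | select src sub φ out hsrc _ => exact complete_columnarSelect out hsrc
  | group src sub φ v out hsrc _ => exact complete_columnarGroup v out hsrc

theorem evalStandard_of_complete {I : ColumnInstance S D} (hI : I.Complete) {n : ℕ}
    (Q : Query S D n) (hQ : Q.NoMissing) :
    Q.evalStandard I.fullOuterJoin = (Q.evalColumnar I).fullOuterJoin := by
  induction Q with
  | table R => rfl
  | select src sub φ out hsrc hsub =>
    rw [evalStandard, evalColumnar, columnarSelect_fullOuterJoin]
    simp only [hsrc _ (hQ.1 _), hsub _ (hQ.2.1 _)]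
    rw [standardRows_of_complete ∅ (fun i => complete_evalColumnar hI (src i))
      fun j => complete_evalColumnar hI (sub j), Multiset.map_map]
    rfl
  | group src sub φ v out hsrc hsub =>
    have hC := fun i => complete_evalColumnar hI (src i)
    have h := standardRows_of_complete (φ := φ) (Set.range v) hC
      fun j => complete_evalColumnar hI (sub j)
    simp only [← hsrc _ (hQ.1 _), ← hsub _ (hQ.2.1 _)] at h
    rw [evalStandard_group _ src sub φ v out h, evalColumnar, columnarGroup_fullOuterJoin]
    refine Multiset.map_congr rfl fun w hw => funext fun c => ?_
    cases out c with
    | key e => rfl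
    | agg γ e =>
      exact (groupEntry_agg_of_complete hC γ e ((Set.Finite.mem_toFinset _).1 hw)).symm

end Query

end Translation

end SQL

theorem proposition2 (S : SQL.Dialect) (D : SQL.Schema) (n : ℕ) (Qcs : SQL.Query S D n) :
    (∃ Q3vl : SQL.Query S D n, Q3vl.NoMissing ∧
      ∀ I' : SQL.ColumnInstance S D,
        (SQL.ColumnNF.normalize
          (Q3vl.evalStandard (SQL.ColumnInstance.fullOuterJoin I'))).Same
          (Qcs.evalColumnar I')) ∧
    (Qcs.NoMissing → ∀ I' : SQL.ColumnInstance S D, SQL.ColumnInstance.Complete I' →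
        (SQL.ColumnNF.normalize
          (Qcs.evalStandard (SQL.ColumnInstance.fullOuterJoin I'))).Same
          (Qcs.evalColumnar I')) := by

  refine ⟨⟨Qcs.toStandard, Qcs.noMissing_toStandard, fun I' => ?_⟩, fun hQ I' hI => ?_⟩
  · rw [Qcs.evalStandard_toStandard I']
    exact SQL.ColumnNF.normalize_fullOuterJoin_same _
  · rw [Qcs.evalStandard_of_complete hI hQ]
    exact SQL.ColumnNF.normalize_fullOuterJoin_same _
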